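/- A double occurrence word is a finite sequence in which every letter that appears, appears exactly twice. Its interlacement graph has as vertices the letters appearing in the word, and two distinct vertices $a$ and $b$ are adjacent if and only if the corresponding letters appear in the word in the order $abab$ or $baba$ (not necessarily consecutively). A simple graph is a circle graph if it is isomorphic to the interlacement graph of a double occurrence word. Two distinct vertices of a graph are twins if they have the same neighbors outside the pair. Theorem. Let $G$ be a nonempty 3-regular circle graph. Then $G$ has at least two disjoint pairs of twin vertices; that is, there are four distinct vertices $a,b,c,d$ of $G$ such that $a,b$ are twins and $c,d$ are twins. -/

import Mathlib

universe u

/-- A double occurrence word: every letter that appears in `W` appears exactly twice. -/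
def IsDoubleOccurrenceWord {α : Type u} (W : List α) : Prop :=
  open Classical in ∀ a ∈ W, W.count a = 2

/-- The interlacement graph of a word `W`: the vertices are the letters appearing in `W`, and two
distinct letters `a`, `b` are adjacent if they appear in `W` in the order `abab` or `baba`
(not necessarily consecutively). -/
def interlacementGraph {α : Type u} (W : List α) : SimpleGraph {a : α // a ∈ W} where
  Adj a b := a ≠ b ∧
    (List.Sublist [a.1, b.1, a.1, b.1] W ∨ List.Sublist [b.1, a.1, b.1, a.1] W)
  symm := ⟨fun _ _ h => ⟨h.1.symm, h.2.symm⟩⟩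
  loopless := ⟨fun _ h => h.1 rfl⟩

/-- A circle graph: a simple graph isomorphic to the interlacement graph of some double
occurrence word. -/
def IsCircleGraph {V : Type u} (G : SimpleGraph V) : Prop :=
  ∃ (α : Type u) (W : List α), IsDoubleOccurrenceWord W ∧ Nonempty (G ≃g interlacementGraph W)

/-- Two distinct vertices are twins if they have the same neighbors outside the pair. -/
def IsTwinPair {V : Type u} (G : SimpleGraph V) (v₁ v₂ : V) : Prop :=
  v₁ ≠ v₂ ∧ ∀ w : V, w ≠ v₁ → w ≠ v₂ → (G.Adj v₁ w ↔ G.Adj v₂ w)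

/-! Draw the graph as chords with ends on a line, and let v be a chord whose closed arc contains no
twins. By induction on length, the arc is short (three ends, all of neighbors of v) or medium (two
crossing chords interleaved with three ends of neighbors): v has only three neighbors, and four
rigid patterns of ends force twins or a fourth neighbor (`hasTwins_or_isShort_or_isMedium`). Cutting
the circle elsewhere turns the other side of v into its arc. If neither side contains twins, then
both are short or medium; every combination but short-short contradicts cubicity, and short-short
makes v adjacent to all other vertices, so that the graph is K4. Hence, outside K4, every vertex v
has a twin pair with no member adjacent to v (`exists_isTwinPair_not_adj`). Applying this again at a
vertex chosen from the first pair c, d, or at a common neighbor of c and d, gives a disjoint pair.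
-/

/-- The chords of a circle graph on `n` points of a line: the chord `v` joins `l v` to `r v`. -/
structure ChordDiagram {V : Type u} (G : SimpleGraph V) (n : ℕ) where
  l : V → ℕ
  r : V → ℕ
  l_lt_r : ∀ v, l v < r v
  r_lt : ∀ v, r v < n
  l_ne : ∀ {v w}, v ≠ w → l v ≠ l w
  r_ne : ∀ {v w}, v ≠ w → r v ≠ r w
  l_ne_r : ∀ v w, l v ≠ r w
  cover : ∀ i < n, ∃ v, l v = i ∨ r v = i
  adj_iff : ∀ v w, G.Adj v w ↔
    (l v < l w ∧ l w < r v ∧ r v < r w) ∨ (l w < l v ∧ l v < r w ∧ r w < r v)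

/-- Every vertex has exactly three neighbors. -/
def IsCubic {V : Type u} (G : SimpleGraph V) : Prop :=
  ∀ v, ∃ x y z, x ≠ y ∧ x ≠ z ∧ y ≠ z ∧ ∀ w, G.Adj v w ↔ w = x ∨ w = y ∨ w = z

theorem IsCubic.not_four {V : Type u} {G : SimpleGraph V} (hG : IsCubic G) {v a b c d : V}
    (ha : G.Adj v a) (hb : G.Adj v b) (hc : G.Adj v c) (hd : G.Adj v d)
    (hab : a ≠ b) (hac : a ≠ c) (had : a ≠ d) (hbc : b ≠ c) (hbd : b ≠ d) (hcd : c ≠ d) :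
    False := by
  obtain ⟨x, y, z, -, -, -, h⟩ := hG v
  rw [h] at ha hb hc hd
  grind

theorem IsCubic.eq_of_three {V : Type u} {G : SimpleGraph V} (hG : IsCubic G) {v a b c : V}
    (ha : G.Adj v a) (hb : G.Adj v b) (hc : G.Adj v c)
    (hab : a ≠ b) (hac : a ≠ c) (hbc : b ≠ c) {w : V} (hw : G.Adj v w) :
    w = a ∨ w = b ∨ w = c := by
  by_contra! h
  exact hG.not_four ha hb hc hw hab hac h.1.symm hbc h.2.1.symm h.2.2.symm

/-! ### Arcs without twins are short or medium. -/

namespace ChordDiagram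

variable {V : Type u} {G : SimpleGraph V} {n : ℕ} (D : ChordDiagram G n)

/-- The closed arc of `v` contains two chords that are twins. -/
def HasTwins (v : V) : Prop :=
  ∃ a b, IsTwinPair G a b ∧ D.l v ≤ D.l a ∧ D.r a ≤ D.r v ∧ D.l v ≤ D.l b ∧ D.r b ≤ D.r v

/-- The arc of `v` contains three points, and no chord. -/
def IsShort (v : V) : Prop :=
  D.r v = D.l v + 4 ∧ ∀ w, ¬ (D.l v < D.l w ∧ D.r w < D.r v)

/-- The arc of `v` contains seven points, in the pattern `d p e q d r e`. -/
def IsMedium (v : V) : Prop :=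
  D.r v = D.l v + 8 ∧ ∃ d e q, D.l d = D.l v + 1 ∧ D.r d = D.l v + 5 ∧
    D.l e = D.l v + 3 ∧ D.r e = D.l v + 7 ∧ (D.l q = D.l v + 4 ∨ D.r q = D.l v + 4) ∧
    G.Adj q v ∧ G.Adj q d ∧ G.Adj q e

variable {D}

theorem ne_of_l {v w : V} (h : D.l v ≠ D.l w) : v ≠ w := fun e => h (e ▸ rfl)

theorem eq_of_l {v w : V} (h : D.l v = D.l w) : v = w := by
  by_contra e
  exact D.l_ne e h

theorem eq_of_r {v w : V} (h : D.r v = D.r w) : v = w := by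
  by_contra e
  exact D.r_ne e h

/-- A medium arc inside a larger arc without twins produces an arc that is neither short nor
medium. -/
theorem not_isMedium_of_inner (hG : IsCubic G) {v w : V}
    (hinner : ∀ u, D.l v < D.l u → D.r u < D.r v → D.IsShort u ∨ D.IsMedium u)
    (hl : D.l v < D.l w) (hr : D.r w < D.r v) : ¬ D.IsMedium w := by
  rintro ⟨hlen, d, e, q, h1, h2, h3, h4, hq, aw, ad, ae⟩
  have hlr := D.l_lt_r q
  -- The three neighbors of `q` are `w`, `d`, `e`, so `q` cannot cross `v` and lies inside its arc.
  have hv : ¬ G.Adj q v := fun av =>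
    hG.not_four aw ad ae av (D.ne_of_l (by omega)) (D.ne_of_l (by omega)) (D.ne_of_l (by omega))
      (D.ne_of_l (by omega)) (D.ne_of_l (by omega)) (D.ne_of_l (by omega))
  have hqv : q ≠ v := by rintro rfl; omega
  have := D.l_ne hqv
  have := D.r_ne hqv
  have hqw := aw.ne
  have := D.l_ne hqw
  have := D.r_ne hqw
  rw [D.adj_iff] at hv
  -- With length 4, `q` would share an end with `w`; with length 8, its own inner chords would
  -- collide with `d` or `e`.
  rcases hinner q (by omega) (by omega) with ⟨hs, -⟩ | ⟨hs, d', e', q', g1, g2, g3, g4, -⟩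
  · omega
  · rcases hq with hq | hq
    · exact D.l_ne_r d' d (by omega)
    · exact D.l_ne_r e e' (by omega)

/-- Two chords of length four with consecutive left ends are twins. -/
theorem isTwinPair_of_succ {a b : V} (ha : D.r a = D.l a + 4) (hb : D.r b = D.l b + 4)
    (hab : D.l b = D.l a + 1) : IsTwinPair G a b := by
  refine ⟨D.ne_of_l (by omega), fun w hwa hwb => ?_⟩
  have := D.l_ne hwa
  have := D.l_ne hwb
  have := D.r_ne hwa
  have := D.r_ne hwb
  have := D.l_ne_r w a
  have := D.l_ne_r w b
  have := D.l_ne_r a w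
  have := D.l_ne_r b w
  rw [D.adj_iff, D.adj_iff]
  omega

/-- A chord `a` of length four inside the arc of `v` that is crossed by three neighbors of `v` is
a twin of `v`. -/
theorem isTwinPair_of_three (hG : IsCubic G) {v a s t u : V} (ha : D.r a = D.l a + 4)
    (hl : D.l v < D.l a) (hr : D.r a < D.r v)
    (hs : G.Adj v s) (hs' : D.l s = D.l a + 1 ∨ D.r s = D.l a + 1)
    (ht : G.Adj v t) (ht' : D.l t = D.l a + 2 ∨ D.r t = D.l a + 2)
    (hu : G.Adj v u) (hu' : D.l u = D.l a + 3 ∨ D.r u = D.l a + 3) : IsTwinPair G v a := by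
  have hs2 := (D.adj_iff v s).1 hs
  have ht2 := (D.adj_iff v t).1 ht
  have hu2 := (D.adj_iff v u).1 hu
  have has : G.Adj a s := (D.adj_iff a s).2 (by omega)
  have hat : G.Adj a t := (D.adj_iff a t).2 (by omega)
  have hau : G.Adj a u := (D.adj_iff a u).2 (by omega)
  have hst : s ≠ t := by rintro rfl; omega
  have hsu : s ≠ u := by rintro rfl; omega
  have htu : t ≠ u := by rintro rfl; omega
  refine ⟨D.ne_of_l (by omega), fun w _ _ => ⟨fun h => ?_, fun h => ?_⟩⟩
  · rcases hG.eq_of_three hs ht hu hst hsu htu h with rfl | rfl | rfl <;> assumption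
  · rcases hG.eq_of_three has hat hau hst hsu htu h with rfl | rfl | rfl <;> assumption

theorem hasTwins_or_isShort_or_isMedium_of_inner (hG : IsCubic G) {v : V}
    (hinner : ∀ u, D.l v < D.l u → D.r u < D.r v → D.IsShort u) :
    D.HasTwins v ∨ D.IsShort v ∨ D.IsMedium v := by
  by_contra! hcon
  obtain ⟨htw, hsh, hmed⟩ := hcon
  have hlrv := D.l_lt_r v
  -- `O` marks left ends of chords inside the arc, all of length 4; `S` marks ends of neighbors of
  -- `v`. Each neighbor has just one end inside, so `S` has at most three points.
  let O : ℕ → Prop := fun i => ∃ u, D.l u = i ∧ D.r u = i + 4 ∧ D.l v < i ∧ i + 4 < D.r v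
  let S : ℕ → Prop := fun i => ∃ u, G.Adj v u ∧ (D.l u = i ∨ D.r u = i) ∧ D.l v < i ∧ i < D.r v
  have O_bd : ∀ i, O i → D.l v < i ∧ i + 4 < D.r v := fun i ⟨_, _, _, h⟩ => h
  have succ : ∀ i, O i → O (i + 1) → False := by
    rintro i ⟨a, a1, a2, a3, a4⟩ ⟨b, b1, b2, b3, b4⟩
    exact htw ⟨a, b, isTwinPair_of_succ (D := D) (by omega) (by omega) (by omega), by omega, by omega,
      by omega, by omega⟩
  have three : ∀ i, O i → S (i + 1) → S (i + 2) → S (i + 3) → False := by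
    rintro i ⟨a, a1, a2, a3, a4⟩ ⟨s, s1, s2, -⟩ ⟨t, t1, t2, -⟩ ⟨u, u1, u2, -⟩
    subst a1
    exact htw ⟨v, a, isTwinPair_of_three hG a2 a3 (by omega) s1 s2 t1 t2 u1 u2, by omega,
      by omega, by omega, by omega⟩
  have S_ne : ∀ {i j s t}, i ≠ j → G.Adj v s → (D.l s = i ∨ D.r s = i) → (D.l v < i ∧ i < D.r v) →
      (D.l t = j ∨ D.r t = j) → (D.l v < j ∧ j < D.r v) → s ≠ t := by
    rintro i j s t hij hs h1 h2 h3 h4 rfl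
    rw [D.adj_iff] at hs
    omega
  have four : ∀ i j k m, i < j → j < k → k < m → S i → S j → S k → S m → False := by
    rintro i j k m hij hjk hkm ⟨a, a1, a2, a3⟩ ⟨b, b1, b2, b3⟩ ⟨c, c1, c2, c3⟩ ⟨d, d1, d2, d3⟩
    exact hG.not_four a1 b1 c1 d1 (S_ne (by omega) a1 a2 a3 b2 b3) (S_ne (by omega) a1 a2 a3 c2 c3)
      (S_ne (by omega) a1 a2 a3 d2 d3) (S_ne (by omega) b1 b2 b3 c2 c3)
      (S_ne (by omega) b1 b2 b3 d2 d3) (S_ne (by omega) c1 c2 c3 d2 d3)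
  have tri : ∀ i, D.l v < i → i < D.r v → O i ∨ (∃ j, i = j + 4 ∧ O j) ∨ S i := by
    intro i h1 h2
    obtain ⟨u, hu⟩ := D.cover i (h2.trans (D.r_lt v))
    have hne : u ≠ v := by rintro rfl; omega
    have := D.l_ne hne
    have := D.r_ne hne
    have := D.l_lt_r u
    have := D.l_ne_r u v
    have := D.l_ne_r v u
    by_cases hadj : G.Adj v u
    · exact .inr (.inr ⟨u, hadj, hu, h1, h2⟩)
    · rw [D.adj_iff] at hadj
      have g1 : D.l v < D.l u := by omega
      have g2 : D.r u < D.r v := by omega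
      have g3 := (hinner u g1 g2).1
      rcases hu with hu | hu
      · exact .inl ⟨u, hu, by omega, h1, by omega⟩
      · exact .inr (.inl ⟨D.l u, by omega, u, rfl, g3, g1, by omega⟩)
  by_cases hO : ∃ i, O i
  · obtain ⟨i, hi, hmin⟩ : ∃ i, O i ∧ ∀ k < i, ¬ O k := by
      classical exact ⟨Nat.find hO, Nat.find_spec hO, fun k hk => Nat.find_min hO hk⟩
    obtain ⟨j, hj, hmax⟩ : ∃ j, O j ∧ ∀ k, j < k → ¬ O k := by
      classical
      refine ⟨Nat.findGreatest O (D.r v), ?_, fun k hk hOk => ?_⟩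
      · exact Nat.findGreatest_spec (m := i) (by have := O_bd i hi; omega) hi
      · have := Nat.le_findGreatest (n := D.r v) (by have := O_bd k hOk; omega) hOk
        omega
    have hib := O_bd i hi
    have hjb := O_bd j hj
    have left : ∀ k, D.l v < k → k < i + 4 → ¬ O k → S k := by
      intro k h1 h2 hk
      rcases tri k h1 (by omega) with h | ⟨m, rfl, hm⟩ | h
      · exact absurd h hk
      · exact absurd hm (hmin m (by omega))
      · exact h
    have right : ∀ k, j < k → k < D.r v → (∀ m, k = m + 4 → ¬ O m) → S k := by
      intro k h1 h2 hk
      rcases tri k (by omega) h2 with h | ⟨m, h, hm⟩ | h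
      · exact absurd h (hmax k h1)
      · exact absurd hm (hk m h)
      · exact h
    have s1 : S (i + 1) := left _ (by omega) (by omega) (fun h => succ i hi h)
    have s2 : S (i + 2) ∨ S (i + 3) := by
      by_contra! h
      have h2 : O (i + 2) := by
        by_contra h'; exact h.1 (left _ (by omega) (by omega) h')
      have h3 : O (i + 3) := by
        by_contra h'; exact h.2 (left _ (by omega) (by omega) h')
      exact succ _ h2 h3
    have o2 : O (i + 2) ∨ O (i + 3) := by
      by_contra! h
      exact three i hi s1 (left _ (by omega) (by omega) h.1) (left _ (by omega) (by omega) h.2)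
    have t3 : S (j + 3) := by
      refine right _ (by omega) (by omega) fun m hm hOm => succ m hOm ?_
      rwa [show m + 1 = j by omega]
    have t12 : S (j + 1) ∨ S (j + 2) := by
      by_contra! h
      have h1 : ∃ m, j + 1 = m + 4 ∧ O m := by
        by_contra! h'; exact h.1 (right _ (by omega) (by omega) h')
      have h2 : ∃ m, j + 2 = m + 4 ∧ O m := by
        by_contra! h'; exact h.2 (right _ (by omega) (by omega) h')
      obtain ⟨m, e1, hm⟩ := h1
      obtain ⟨m', e2, hm'⟩ := h2
      obtain rfl : m' = m + 1 := by omega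
      exact succ _ hm hm'
    have hji : i + 2 ≤ j := by
      by_contra h
      rcases o2 with h' | h' <;> exact hmax _ (by omega) h'
    -- The first chord, at `i`, forces two points of `S` up to `i + 3`, and the last, at `j`, two
    -- from `j + 1` on; these are four points unless `j = i + 2`.
    have hj2 : j = i + 2 := by
      by_contra h
      rcases s2 with s2 | s2 <;> rcases t12 with t | t <;>
        exact four _ _ _ _ (by omega) (by omega) (by omega) s1 s2 t t3
    subst hj2
    have s3 : S (i + 3) := left _ (by omega) (by omega) (succ (i + 2) hj)
    have hil : i = D.l v + 1 := by
      by_contra h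
      exact four (D.l v + 1) _ _ _ (by omega) (by omega) (by omega)
        (left _ (by omega) (by omega) (hmin _ (by omega))) s1 s3 t3
    have hir : D.r v = i + 7 := by
      by_contra h
      exact four _ _ _ (i + 7) (by omega) (by omega) (by omega) s1 s3 t3
        (right _ (by omega) (by omega) fun m hm => hmax m (by omega))
    obtain ⟨d, d1, d2, -⟩ := hi
    obtain ⟨e, e1, e2, -⟩ := hj
    obtain ⟨q, q1, q2, -⟩ := s3
    have q3 := (D.adj_iff v q).1 q1
    exact hmed ⟨by omega, d, e, q, by omega, by omega, by omega, by omega, by omega, q1.symm,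
      (D.adj_iff q d).2 (by omega), (D.adj_iff q e).2 (by omega)⟩
  · push Not at hO
    have allS : ∀ k, D.l v < k → k < D.r v → S k := by
      intro k h1 h2
      rcases tri k h1 h2 with h | ⟨m, _, hm⟩ | h
      · exact absurd h (hO k)
      · exact absurd hm (hO m)
      · exact h
    refine hsh ⟨?_, fun w ⟨h1, h2⟩ => ?_⟩
    · by_contra hne
      rcases lt_or_ge (D.l v + 4) (D.r v) with h | h
      · exact four (D.l v + 1) (D.l v + 2) (D.l v + 3) (D.l v + 4) (by omega) (by omega) (by omega)
          (allS _ (by omega) (by omega)) (allS _ (by omega) (by omega))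
          (allS _ (by omega) (by omega)) (allS _ (by omega) (by omega))
      · obtain ⟨x, y, z, hxy, hxz, hyz, hN⟩ := hG v
        have hx := (D.adj_iff v x).1 ((hN x).2 (by simp))
        have hy := (D.adj_iff v y).1 ((hN y).2 (by simp))
        have hz := (D.adj_iff v z).1 ((hN z).2 (by simp))
        have := D.l_ne hxy
        have := D.l_ne hxz
        have := D.l_ne hyz
        have := D.r_ne hxy
        have := D.r_ne hxz
        have := D.r_ne hyz
        have := D.l_ne_r x y
        have := D.l_ne_r x z
        have := D.l_ne_r y z
        have := D.l_ne_r y x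
        have := D.l_ne_r z x
        have := D.l_ne_r z y
        omega
    · have h3 := (hinner w h1 h2).1
      exact hO (D.l w) ⟨w, rfl, h3, h1, by omega⟩

theorem HasTwins.mono {v w : V} (hl : D.l v ≤ D.l w) (hr : D.r w ≤ D.r v) (h : D.HasTwins w) :
    D.HasTwins v := by
  obtain ⟨a, b, hab, h1, h2, h3, h4⟩ := h
  exact ⟨a, b, hab, hl.trans h1, h2.trans hr, hl.trans h3, h4.trans hr⟩

/-- Strong induction on the length of the arc; inner medium arcs are excluded, so only inner short
ones remain. -/
theorem hasTwins_or_isShort_or_isMedium (hG : IsCubic G) (v : V) :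
    D.HasTwins v ∨ D.IsShort v ∨ D.IsMedium v := by
  induction hm : D.r v - D.l v using Nat.strong_induction_on generalizing v with
  | _ m ih =>
    by_cases ht : D.HasTwins v
    · exact .inl ht
    · have key : ∀ u, D.l v < D.l u → D.r u < D.r v → D.IsShort u ∨ D.IsMedium u := by
        intro u h1 h2
        have := D.l_lt_r u
        exact (ih (D.r u - D.l u) (by omega) u rfl).resolve_left
          fun h => ht (h.mono h1.le h2.le)
      exact hasTwins_or_isShort_or_isMedium_of_inner hG fun u h1 h2 =>
        (key u h1 h2).resolve_right (not_isMedium_of_inner hG key h1 h2)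

theorem HasTwins.exists_not_adj {v : V} (h : D.HasTwins v) :
    ∃ a b, IsTwinPair G a b ∧ ¬ G.Adj v a ∧ ¬ G.Adj v b := by
  obtain ⟨a, b, hab, h1, h2, h3, h4⟩ := h
  refine ⟨a, b, hab, ?_, ?_⟩ <;> rw [D.adj_iff] <;> omega

end ChordDiagram
-- Rotating the circle and comparing the two sides of a chord.
namespace ChordDiagram

variable {V : Type u} {G : SimpleGraph V} {n : ℕ}

section Rotate

variable (D : ChordDiagram G n) (v : V)

/-- The left end of `x` after cutting the circle just before the right end of `v`. -/
def rotateL (x : V) : ℕ :=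
  if D.r v ≤ D.l x then D.l x - D.r v
  else if D.r v ≤ D.r x then D.r x - D.r v else D.l x + (n - D.r v)

/-- The right end of `x` after cutting the circle just before the right end of `v`. -/
def rotateR (x : V) : ℕ :=
  if D.r v ≤ D.l x then D.r x - D.r v
  else if D.r v ≤ D.r x then D.l x + (n - D.r v) else D.r x + (n - D.r v)

theorem rotate_cases (x : V) :
    (D.r v ≤ D.l x ∧ D.rotateL v x = D.l x - D.r v ∧ D.rotateR v x = D.r x - D.r v) ∨
    (D.l x < D.r v ∧ D.r v ≤ D.r x ∧ D.rotateL v x = D.r x - D.r v ∧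
      D.rotateR v x = D.l x + (n - D.r v)) ∨
    (D.r x < D.r v ∧ D.rotateL v x = D.l x + (n - D.r v) ∧
      D.rotateR v x = D.r x + (n - D.r v)) := by
  have := D.l_lt_r x
  unfold rotateL rotateR
  split_ifs <;> omega

/-- The chord diagram obtained by cutting the circle just before the right end of `v`. -/
def rotate : ChordDiagram G n where
  l := D.rotateL v
  r := D.rotateR v
  l_lt_r x := by
    have := D.l_lt_r x
    have := D.r_lt x
    have := D.r_lt v
    have := D.rotate_cases v x
    omega
  r_lt x := by
    have := D.l_lt_r x
    have := D.r_lt x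
    have := D.r_lt v
    have := D.rotate_cases v x
    omega
  l_ne {x y} hxy := by
    have := D.l_ne hxy
    have := D.r_ne hxy
    have := D.l_ne_r x y
    have := D.l_ne_r y x
    have := D.r_lt v
    have := D.r_lt x
    have := D.r_lt y
    have := D.l_lt_r x
    have := D.l_lt_r y
    rcases D.rotate_cases v x with h | h | h <;> rcases D.rotate_cases v y with h' | h' | h' <;>
      omega
  r_ne {x y} hxy := by
    have := D.l_ne hxy
    have := D.r_ne hxy
    have := D.l_ne_r x y
    have := D.l_ne_r y x
    have := D.r_lt v
    have := D.r_lt x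
    have := D.r_lt y
    have := D.l_lt_r x
    have := D.l_lt_r y
    rcases D.rotate_cases v x with h | h | h <;> rcases D.rotate_cases v y with h' | h' | h' <;>
      omega
  l_ne_r x y := by
    have hxy : D.l x ≠ D.l y ∧ D.r x ≠ D.r y ∨ D.l x = D.l y ∧ D.r x = D.r y := by
      by_cases h : x = y
      · exact .inr (by simp [h])
      · exact .inl ⟨D.l_ne h, D.r_ne h⟩
    have := D.l_ne_r x y
    have := D.l_ne_r y x
    have := D.r_lt v
    have := D.r_lt x
    have := D.r_lt y
    have := D.l_lt_r x
    have := D.l_lt_r y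
    rcases D.rotate_cases v x with h | h | h <;> rcases D.rotate_cases v y with h' | h' | h' <;>
      omega
  cover i hi := by
    have := D.r_lt v
    obtain ⟨x, hx⟩ : ∃ x, (i < n - D.r v ∧ (D.l x = i + D.r v ∨ D.r x = i + D.r v)) ∨
        (n - D.r v ≤ i ∧ (D.l x = i - (n - D.r v) ∨ D.r x = i - (n - D.r v))) := by
      rcases lt_or_ge i (n - D.r v) with h | h
      · obtain ⟨x, hx⟩ := D.cover (i + D.r v) (by omega)
        exact ⟨x, .inl ⟨h, hx⟩⟩
      · obtain ⟨x, hx⟩ := D.cover (i - (n - D.r v)) (by omega)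
        exact ⟨x, .inr ⟨h, hx⟩⟩
    have := D.l_lt_r x
    have := D.r_lt x
    refine ⟨x, ?_⟩
    rcases D.rotate_cases v x with h | h | h <;> omega
  adj_iff x y := by
    have hxy : D.l x ≠ D.l y ∧ D.r x ≠ D.r y ∨ D.l x = D.l y ∧ D.r x = D.r y := by
      by_cases h : x = y
      · exact .inr (by simp [h])
      · exact .inl ⟨D.l_ne h, D.r_ne h⟩
    have := D.l_ne_r x y
    have := D.l_ne_r y x
    have := D.r_lt v
    have := D.r_lt x
    have := D.r_lt y
    have := D.l_lt_r x
    have := D.l_lt_r y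
    rw [D.adj_iff]
    rcases D.rotate_cases v x with h | h | h <;> rcases D.rotate_cases v y with h' | h' | h' <;>
      omega

theorem rotate_spec (x : V) :
    (D.r v ≤ D.l x ∧ (D.rotate v).l x = D.l x - D.r v ∧ (D.rotate v).r x = D.r x - D.r v) ∨
    (D.l x < D.r v ∧ D.r v ≤ D.r x ∧ (D.rotate v).l x = D.r x - D.r v ∧
      (D.rotate v).r x = D.l x + (n - D.r v)) ∨
    (D.r x < D.r v ∧ (D.rotate v).l x = D.l x + (n - D.r v) ∧
      (D.rotate v).r x = D.r x + (n - D.r v)) :=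
  D.rotate_cases v x

/-- The second cut falls at the original left end of `v`, so the original side is again the arc.
This lets the two sides exchange roles. -/
theorem IsShort.rotate_rotate {D : ChordDiagram G n} {v : V} (h : D.IsShort v) :
    ((D.rotate v).rotate v).IsShort v := by
  obtain ⟨h1, h2⟩ := h
  have a0 := D.r_lt v
  have a1 := D.rotate_spec v v
  have a2 := (D.rotate v).rotate_spec v v
  refine ⟨by omega, fun w hw => h2 w ?_⟩
  have b0 := D.l_lt_r w
  have b1 := D.r_lt w
  have b2 := D.rotate_spec v w
  have b3 := (D.rotate v).rotate_spec v w
  omega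

end Rotate

variable {D : ChordDiagram G n}

/-- The chord `q` already crosses `v`, `d`, `e`. Its other end is one of the free points 2, 4, 6 of
the opposite side, each of which lies under `d'` = (1, 5) or `e'` = (3, 7): a fourth neighbor. -/
theorem not_isMedium_and_isMedium_rotate (hG : IsCubic G) {v : V} (h : D.IsMedium v)
    (h' : (D.rotate v).IsMedium v) : False := by
  obtain ⟨hlen, d, e, q, d1, d2, e1, e2, hq, av, ad, ae⟩ := h
  obtain ⟨hlen', d', e', -, d1', d2', e1', e2', -⟩ := h'
  have hvn := D.r_lt v
  have hde : d ≠ e := D.ne_of_l (by omega)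
  have hv := D.rotate_spec v v
  have hn : n = 16 ∧ (D.rotate v).l v = 0 := by omega
  obtain ⟨rfl, Ev⟩ := hn
  clear hv
  have Ed : 8 < (D.rotate v).l d := by
    have := D.rotate_spec v d
    omega
  have Ee : 8 < (D.rotate v).l e := by
    have := D.rotate_spec v e
    omega
  have Eq : 8 < (D.rotate v).r q := by
    have := D.rotate_spec v q
    have := D.l_lt_r q
    omega
  have Eqv := ((D.rotate v).adj_iff q v).1 av
  generalize D.rotate v = E at hlen' d1' d2' e1' e2' Ev Ed Ee Eq Eqv
  have Eq' : 0 < E.l q ∧ E.l q < 8 := by omega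
  clear Eqv hq d1 d2 e1 e2 hlen
  have hvd : v ≠ d := E.ne_of_l (by omega)
  have hve : v ≠ e := E.ne_of_l (by omega)
  have ne_d : q ≠ d' := by rintro rfl; omega
  have ne_e : q ≠ e' := by rintro rfl; omega
  have := E.l_ne ne_d
  have := E.l_ne ne_e
  have := E.l_ne_r q d'
  have := E.l_ne_r q e'
  have key : G.Adj q d' ∨ G.Adj q e' := by
    rw [E.adj_iff, E.adj_iff]
    omega
  rcases key with key | key <;>
  exact hG.not_four av ad ae key hvd hve (E.ne_of_l (by omega)) hde (E.ne_of_l (by omega))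
    (E.ne_of_l (by omega))

/-- Three chords join the points 1, 2, 3 to 6, 8, 10, and `q` ends at 8. The others may not cross
`q`, so the three are nested, and the innermost has only two neighbors. -/
theorem not_isMedium_and_isShort_rotate (hG : IsCubic G) {v : V} (h : D.IsMedium v)
    (h' : (D.rotate v).IsShort v) : False := by
  obtain ⟨hlen, d, e, q, d1, d2, e1, e2, hq, av, ad, ae⟩ := h
  obtain ⟨hlen', hinner⟩ := h'
  have hv := D.rotate_spec v v
  have hd := D.rotate_spec v d
  have he := D.rotate_spec v e
  have hq' := D.rotate_spec v q
  have := D.r_lt v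
  have := D.l_lt_r q
  generalize D.rotate v = E at hlen' hinner hv hd he hq'
  have hn : n = 12 := by omega
  subst hn
  have Ed : E.l d = 5 ∧ E.r d = 9 := by omega
  have Ee : E.l e = 7 ∧ E.r e = 11 := by omega
  have Ev : E.l v = 0 ∧ E.r v = 4 := by omega
  have Eqv := (E.adj_iff q v).1 av
  have Eq : E.r q = 8 ∧ 0 < E.l q ∧ E.l q < 4 := by omega
  clear hv hd he hq' hq d1 d2 e1 e2 hlen' hlen
  have hvd : v ≠ d := E.ne_of_l (by omega)
  have hve : v ≠ e := E.ne_of_l (by omega)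
  have hde : d ≠ e := E.ne_of_l (by omega)
  have hnbr : ∀ x, G.Adj q x → x = v ∨ x = d ∨ x = e := fun x hx =>
    hG.eq_of_three av ad ae hvd hve hde hx
  -- On the medium side, `d` = (5, 9) and `e` = (7, 11) leave only 6, 8, 10 free. The equivalence
  -- tells `omega` when `x` is `q`.
  have letter : ∀ i, 0 < i → i < 4 → ∃ x, E.l x = i ∧ (E.r x = 6 ∨ E.r x = 8 ∨ E.r x = 10) ∧
      (E.l x = E.l q ↔ E.r x = E.r q) ∧ ¬ G.Adj q x := by
    intro i h1 h2
    obtain ⟨x, hx⟩ := E.cover i (by omega)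
    have hxv : x ≠ v := by rintro rfl; omega
    have hxd : x ≠ d := by rintro rfl; omega
    have hxe : x ≠ e := by rintro rfl; omega
    have := E.l_ne hxv
    have := E.r_ne hxv
    have := E.r_ne hxd
    have := E.r_ne hxe
    have := E.l_ne_r d x
    have := E.l_ne_r e x
    have := E.l_ne_r x v
    have := E.l_ne_r v x
    have := E.r_lt x
    have := E.l_lt_r x
    have := hinner x
    refine ⟨x, by omega, by omega, ⟨fun h => by rw [eq_of_l h], fun h => by rw [eq_of_r h]⟩,
      fun h => ?_⟩
    rcases hnbr x h with h | h | h <;> contradiction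
  obtain ⟨a, a1, a2, a4, a3⟩ := letter 1 (by omega) (by omega)
  obtain ⟨b, b1, b2, b4, b3⟩ := letter 2 (by omega) (by omega)
  obtain ⟨c, c1, c2, c4, c3⟩ := letter 3 (by omega) (by omega)
  rw [E.adj_iff] at a3 b3 c3
  have := E.r_ne (E.ne_of_l (show E.l a ≠ E.l b by omega))
  have := E.r_ne (E.ne_of_l (show E.l a ≠ E.l c by omega))
  have := E.r_ne (E.ne_of_l (show E.l b ≠ E.l c by omega))
  have ha : E.r a = 10 := by omega
  have hb : E.r b = 8 := by omega
  have hc : E.r c = 6 := by omega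
  have two : ∀ x, G.Adj c x → x = v ∨ x = d := by
    intro x hx
    by_contra! hne
    have hxa : x ≠ a := by rintro rfl; rw [E.adj_iff] at hx; omega
    have hxb : x ≠ b := by rintro rfl; rw [E.adj_iff] at hx; omega
    have hxe : x ≠ e := by rintro rfl; rw [E.adj_iff] at hx; omega
    have := E.l_ne hx.ne
    have := E.l_ne hne.1
    have := E.l_ne hne.2
    have := E.l_ne hxa
    have := E.l_ne hxb
    have := E.l_ne hxe
    have := E.r_ne hx.ne
    have := E.r_ne hne.1
    have := E.r_ne hne.2
    have := E.r_ne hxa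
    have := E.r_ne hxb
    have := E.r_ne hxe
    have := E.l_ne_r v x
    have := E.l_ne_r x v
    have := E.l_ne_r d x
    have := E.l_ne_r x d
    have := E.l_ne_r e x
    have := E.l_ne_r x e
    have := E.r_lt x
    rw [E.adj_iff] at hx
    omega
  obtain ⟨x, y, z, hxy, hxz, hyz, hN⟩ := hG c
  have := two x ((hN x).2 (by simp))
  have := two y ((hN y).2 (by simp))
  have := two z ((hN z).2 (by simp))
  grind

theorem exists_isTwinPair_not_adj (D : ChordDiagram G n) (hG : IsCubic G) (v : V) :
    (∃ a b, IsTwinPair G a b ∧ ¬ G.Adj v a ∧ ¬ G.Adj v b) ∨ ∀ w, w ≠ v → G.Adj v w := by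
  by_contra! hcon
  obtain ⟨htw, w, hwv, hw⟩ := hcon
  have no : ∀ E : ChordDiagram G n, E.IsShort v ∨ E.IsMedium v := fun E =>
    (E.hasTwins_or_isShort_or_isMedium hG v).resolve_left fun h => by
      obtain ⟨a, b, hab, ha, hb⟩ := h.exists_not_adj
      exact hb (htw a b hab ha)
  rcases no D with h | h <;> rcases no (D.rotate v) with h' | h'
  -- No chord lies on either side of `v`, so `w` would have to cross it.
  · have h1 := h.2 w
    have h2 := h'.2 w
    have := D.rotate_spec v v
    have := D.rotate_spec v w
    have := D.l_ne hwv
    have := D.r_ne hwv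
    have := D.l_ne_r v w
    have := D.l_ne_r w v
    have := D.l_lt_r v
    have := D.l_lt_r w
    have := D.r_lt v
    have := D.r_lt w
    rw [D.adj_iff] at hw
    omega
  · exact not_isMedium_and_isShort_rotate hG h' h.rotate_rotate
  · exact not_isMedium_and_isShort_rotate hG h h'
  · exact not_isMedium_and_isMedium_rotate hG h h'

end ChordDiagram

/-! ### From one twin pair to two disjoint ones. -/

theorem IsCubic.exists_disjoint_isTwinPair_of_dominating {V : Type u} {G : SimpleGraph V}
    (hG : IsCubic G) {v : V} (hv : ∀ w, w ≠ v → G.Adj v w) :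
    ∃ a b c d : V, IsTwinPair G a b ∧ IsTwinPair G c d ∧
      Disjoint ({a, b} : Set V) ({c, d} : Set V) := by
  obtain ⟨x, y, z, hxy, hxz, hyz, hN⟩ := hG v
  have ax := (hN x).2 (by simp)
  have ay := (hN y).2 (by simp)
  have az := (hN z).2 (by simp)
  have all : ∀ w, w = v ∨ w = x ∨ w = y ∨ w = z := fun w => by
    by_cases h : w = v
    · exact .inl h
    · exact .inr ((hN w).1 (hv w h))
  have complete : ∀ s t, s ≠ t → G.Adj s t := by
    intro s t hst
    obtain ⟨p, q, r, hpq, hpr, hqr, hs⟩ := hG s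
    have hps := ((hs p).2 (by simp)).ne
    have hqs := ((hs q).2 (by simp)).ne
    have hrs := ((hs r).2 (by simp)).ne
    rw [hs]
    have := all p
    have := all q
    have := all r
    have := all s
    have := all t
    grind
  have twin : ∀ s t, s ≠ t → IsTwinPair G s t := fun s t hst =>
    ⟨hst, fun w hs ht => iff_of_true (complete _ _ hs.symm) (complete _ _ ht.symm)⟩
  exact ⟨v, x, y, z, twin _ _ ax.ne, twin _ _ hyz, by simp [ay.ne', az.ne', hxy.symm, hxz.symm]⟩

theorem ChordDiagram.exists_disjoint_isTwinPair {V : Type u} {G : SimpleGraph V} {n : ℕ}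
    (D : ChordDiagram G n) (hG : IsCubic G) (v : V) :
    ∃ a b c d : V, IsTwinPair G a b ∧ IsTwinPair G c d ∧
      Disjoint ({a, b} : Set V) ({c, d} : Set V) := by
  rcases D.exists_isTwinPair_not_adj hG v with ⟨c, d, hcd, -⟩ | h
  swap
  · exact hG.exists_disjoint_isTwinPair_of_dominating h
  by_cases hadj : G.Adj c d
  · rcases D.exists_isTwinPair_not_adj hG c with ⟨e, f, hef, he, hf⟩ | h
    swap
    · exact hG.exists_disjoint_isTwinPair_of_dominating h
    have hed : e ≠ d := by rintro rfl; contradiction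
    have hfd : f ≠ d := by rintro rfl; contradiction
    -- The new pair may contain `c` itself, as `c` is not its own neighbor. But then adjacency to
    -- `d` passes from `c` to `g`, and the twins `c`, `d` give `g` adjacent to `c`.
    have no : ∀ g, IsTwinPair G c g → ¬ G.Adj c g → False := by
      intro g hg hcg
      have hgd : g ≠ d := by rintro rfl; contradiction
      have h1 := (hg.2 d hcd.1.symm hgd.symm).1 hadj
      exact hcg ((hcd.2 g hg.1.symm hgd).2 h1.symm)
    have hec : e ≠ c := by
      rintro rfl
      exact no f hef hf
    have hfc : f ≠ c := by
      rintro rfl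
      exact no e ⟨hef.1.symm, fun w h1 h2 => (hef.2 w h2 h1).symm⟩ he
    exact ⟨c, d, e, f, hcd, hef, by simp [hec, hed, hfc, hfd]⟩
  · obtain ⟨w, _, _, -, -, -, hN⟩ := hG c
    have hcw := (hN w).2 (by simp)
    -- A common neighbor `w` of `c` and `d`: a pair not adjacent to `w` avoids both.
    have hdw := (hcd.2 w hcw.ne' (by rintro rfl; contradiction)).1 hcw
    rcases D.exists_isTwinPair_not_adj hG w with ⟨e, f, hef, he, hf⟩ | h
    swap
    · exact hG.exists_disjoint_isTwinPair_of_dominating h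
    have hec : e ≠ c := by rintro rfl; exact he hcw.symm
    have hfc : f ≠ c := by rintro rfl; exact hf hcw.symm
    have hed : e ≠ d := by rintro rfl; exact he hdw.symm
    have hfd : f ≠ d := by rintro rfl; exact hf hdw.symm
    exact ⟨c, d, e, f, hcd, hef, by simp [hec, hed, hfc, hfd]⟩

/-! ### From double occurrence words to chord diagrams. -/

theorem List.sublist_quadruple_iff {α : Type u} {W : List α} {a b c d : α} :
    [a, b, c, d].Sublist W ↔ ∃ i j k m : ℕ, i < j ∧ j < k ∧ k < m ∧
      W[i]? = some a ∧ W[j]? = some b ∧ W[k]? = some c ∧ W[m]? = some d := by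
  constructor
  · intro h
    obtain ⟨f, hf⟩ := List.sublist_iff_exists_orderEmbedding_getElem?_eq.1 h
    exact ⟨f 0, f 1, f 2, f 3, by simp, by simp, by simp, (hf 0).symm, (hf 1).symm, (hf 2).symm,
      (hf 3).symm⟩
  · rintro ⟨i, j, k, m, hij, hjk, hkm, hi, hj, hk, hm⟩
    obtain ⟨hi', rfl⟩ := List.getElem?_eq_some_iff.1 hi
    obtain ⟨hj', rfl⟩ := List.getElem?_eq_some_iff.1 hj
    obtain ⟨hk', rfl⟩ := List.getElem?_eq_some_iff.1 hk
    obtain ⟨hm', rfl⟩ := List.getElem?_eq_some_iff.1 hm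
    have h := List.map_getElem_sublist (l := W) (is := [⟨i, hi'⟩, ⟨j, hj'⟩, ⟨k, hk'⟩, ⟨m, hm'⟩])
      (by simp; omega)
    simpa using h

theorem IsDoubleOccurrenceWord.exists_positions {α : Type u} {W : List α}
    (hW : IsDoubleOccurrenceWord W) {a : α} (ha : a ∈ W) :
    ∃ i j : ℕ, i < j ∧ j < W.length ∧ ∀ k, W[k]? = some a ↔ k = i ∨ k = j := by
  classical
  have hc : W.count a = 2 := by convert hW a ha
  have h2 : (List.replicate 2 a).Sublist W := List.replicate_sublist_iff.2 hc.ge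
  obtain ⟨f, hf⟩ := List.sublist_iff_exists_orderEmbedding_getElem?_eq.1 h2
  have h0 : W[f 0]? = some a := (hf 0).symm
  have h1 : W[f 1]? = some a := (hf 1).symm
  have h01 : f 0 < f 1 := by simp
  have no : ∀ i j k : ℕ, i < j → j < k → W[i]? = some a → W[j]? = some a → W[k]? = some a →
      False := by
    intro i j k hij hjk hi hj hk
    obtain ⟨hi', hi⟩ := List.getElem?_eq_some_iff.1 hi
    obtain ⟨hj', hj⟩ := List.getElem?_eq_some_iff.1 hj
    obtain ⟨hk', hk⟩ := List.getElem?_eq_some_iff.1 hk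
    have h := List.map_getElem_sublist (l := W) (is := [⟨i, hi'⟩, ⟨j, hj'⟩, ⟨k, hk'⟩])
      (by simp; omega)
    have h3 : (List.replicate 3 a).Sublist W := by simpa [hi, hj, hk, List.replicate] using h
    have := List.replicate_sublist_iff.1 h3
    omega
  refine ⟨f 0, f 1, h01, (List.getElem?_eq_some_iff.1 h1).1, fun k => ⟨fun hk => ?_, ?_⟩⟩
  · by_contra! hne
    rcases lt_or_gt_of_ne hne.1 with h | h
    · exact no _ _ _ h h01 hk h0 h1
    · rcases lt_or_gt_of_ne hne.2 with h' | h'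
      · exact no _ _ _ h h' h0 hk h1
      · exact no _ _ _ h01 h' h0 h1 hk
  · rintro (rfl | rfl) <;> assumption

/-- A circle graph is the crossing graph of a chord diagram. -/
theorem IsCircleGraph.exists_chordDiagram {V : Type u} {G : SimpleGraph V}
    (h : IsCircleGraph G) : ∃ n, Nonempty (ChordDiagram G n) := by
  obtain ⟨α, W, hW, ⟨φ⟩⟩ := h
  choose l r hlr hrn hpos using fun v => hW.exists_positions (φ v).2
  have ne : ∀ {v w : V} {i j : ℕ}, v ≠ w → W[i]? = some (φ v).1 → W[j]? = some (φ w).1 → i ≠ j := by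
    rintro v w i j hvw hi hj rfl
    exact hvw (φ.injective (Subtype.ext (Option.some.inj (hi.symm.trans hj))))
  have hl : ∀ v, W[l v]? = some (φ v).1 := fun v => (hpos v _).2 (.inl rfl)
  have hr : ∀ v, W[r v]? = some (φ v).1 := fun v => (hpos v _).2 (.inr rfl)
  refine ⟨W.length, ⟨⟨l, r, hlr, hrn, fun h => ne h (hl _) (hl _), fun h => ne h (hr _) (hr _),
    fun v w => ?_, fun i hi => ?_, fun v w => ?_⟩⟩⟩
  · by_cases h : v = w
    · exact h ▸ (hlr v).ne
    · exact ne h (hl v) (hr w)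
  · refine ⟨φ.symm ⟨W[i], List.getElem_mem hi⟩, ?_⟩
    have := (hpos (φ.symm ⟨W[i], List.getElem_mem hi⟩) i).1 (by simp [hi])
    omega
  · rw [← φ.map_adj_iff]
    change (φ v ≠ φ w ∧ _) ↔ _
    simp only [List.sublist_quadruple_iff, hpos]
    constructor
    · rintro ⟨-, ⟨i, j, k, m, h⟩ | ⟨i, j, k, m, h⟩⟩ <;> have := hlr v <;> have := hlr w <;> omega
    · intro h
      refine ⟨fun e => ?_, ?_⟩
      · obtain rfl := φ.injective e
        omega
      · rcases h with h | h
        · exact .inl ⟨l v, l w, r v, r w, by omega⟩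
        · exact .inr ⟨l w, l v, r w, r v, by omega⟩

theorem SimpleGraph.IsRegularOfDegree.isCubic {V : Type u} {G : SimpleGraph V} [G.LocallyFinite]
    (h : G.IsRegularOfDegree 3) : IsCubic G := by
  classical
  intro v
  obtain ⟨x, y, z, hxy, hxz, hyz, hs⟩ := Finset.card_eq_three.1 (h v)
  refine ⟨x, y, z, hxy, hxz, hyz, fun w => ?_⟩
  rw [← G.mem_neighborFinset, hs]
  simp

theorem theorem2 {V : Type u} [Nonempty V] (G : SimpleGraph V) [G.LocallyFinite]
    (hcircle : IsCircleGraph G) (hregular : G.IsRegularOfDegree 3) :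
    ∃ a b c d : V, IsTwinPair G a b ∧ IsTwinPair G c d ∧
      Disjoint ({a, b} : Set V) ({c, d} : Set V) := by
  obtain ⟨n, ⟨D⟩⟩ := hcircle.exists_chordDiagram
  exact D.exists_disjoint_isTwinPair hregular.isCubic (Classical.arbitrary V)
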